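/- Let $A:\mathbb R\to\mathbb R$ be infinitely differentiable, with $A$ and each of its derivatives $A^{(p)}$ vanishing exponentially fast at $+\infty$. Let $\sigma:\mathbb R\to\mathbb R$ be nondecreasing (jumps allowed) with $\sigma(t)\to 0$ as $t\to-\infty$ and $\sigma(t)\to\gamma\in(0,1]$ as $t\to+\infty$; let $\sigma'$ denote its Lebesgue--Stieltjes measure $d\sigma$. For $s\in\mathbb R$ and $p\in\mathbb N=\{0,1,2,\dots\}$ let $A_s^{(p)}:\mathbb L^2(\mathbb R_+)\to\mathbb L^2(\mathbb R)$ be the operator with kernel $A_s^{(p)}(t,y)=A^{(p)}(t+y+s)$, $A_s=A_s^{(0)}$, and let $K_2=A_s^\intercal\sigma A_s$ be the operator on $\mathbb L^2(\mathbb R_+)$ with kernel $$K_2(x,y)=\int_{\mathbb R}\sigma(r)A(x+r+s)A(y+r+s)\,dr .$$ Fix $s\in\mathbb R$ such that $\sqrt\sigma A_s$ and $\sqrt\sigma A_s^{(1)}$ are Hilbert--Schmidt, i.e. $\int_0^\infty\!\int_{\mathbb R}\sigma(r)A^{(p)}(r+y+s)^2\,dr\,dy<\infty$ for $p=0,1$,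 and such that $I-K_2$ is invertible on $\mathbb L^2(\mathbb R_+)$. For $p\in\mathbb N$ and $t,t'\in\mathbb R$ put $$q_p(t)=\Big(A_s^{(p)}\frac{I}{I-K_2}|\delta\rangle\Big)(t)=A^{(p)}(t+s)+\int_0^\infty A^{(p)}(t+y+s)\,\big((I-K_2)^{-1}K_2(\cdot,0)\big)(y)\,dy,$$ $$u_p(t,t')=\Big(A_s^{(p)}\frac{I}{I-K_2}A_s^\intercal\Big)(t,t')=\int_0^\infty A^{(p)}(t+y+s)\,\big((I-K_2)^{-1}A(t'+\cdot+s)\big)(y)\,dy .$$ Write $u_p^\intercal(t,t')=u_p(t',t)$, $(q_pq_k^\intercal)(t,t')=q_p(t)q_k(t')$ and $(u_p\sigma'u_k^\intercal)(t,t')=\int_{\mathbb R}u_p(t,v)u_k(t',v)\,d\sigma(v)$. Then all the integrals defining $u_p\sigma'u_k^\intercal$ converge absolutely, and for every $n\in\mathbb N$ the following two functions vanish identically on $\mathbb R^2$: $$\mathcal I_n=u_{2n+1}+u_{2n+1}^\intercal+\sum_{k=0}^{2n}(-1)^{k+1}\big[u_{2n-k}\,\sigma' u_k^\intercal-q_{2n-k}\,q_k^\intercal\big]=0,$$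 $$\mathcal J_n=u_{2n}-u_{2n}^\intercal+\sum_{k=0}^{2n-1}(-1)^{k+1}\big[u_{2n-1-k}\,\sigma' u_k^\intercal-q_{2n-1-k}\,q_k^\intercal\big]=0 .$$ -/

import Mathlib

open MeasureTheory Set Filter Topology
open scoped ContDiff

noncomputable section

namespace InhomFredholm

/-- Lebesgue measure on the half-line `ℝ₊ = (0, ∞)`. -/
abbrev halfLine : Measure ℝ := volume.restrict (Ioi (0 : ℝ))

/-- The real Hilbert space `L²(ℝ₊)`. -/
abbrev L2 : Type := Lp ℝ 2 halfLine

/-- The class in `L²(ℝ₊)` of a square-integrable function (and `0` for any other function). -/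
def toL2 (f : ℝ → ℝ) : L2 :=
  open Classical in if h : MemLp f 2 halfLine then h.toLp f else 0

section IntegralOperator

variable {k : ℝ → ℝ → ℝ}

theorem sq_kernel_integrable (hk : MemLp (Function.uncurry k) 2 (halfLine.prod halfLine)) :
    Integrable (fun z : ℝ × ℝ => (k z.1 z.2) ^ 2) (halfLine.prod halfLine) :=
  hk.integrable_sq

/-- Almost every row of a Hilbert-Schmidt kernel is square integrable. -/
theorem row_memLp (hk : MemLp (Function.uncurry k) 2 (halfLine.prod halfLine)) :
    ∀ᵐ x ∂halfLine, MemLp (k x) 2 halfLine := by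
  filter_upwards [(sq_kernel_integrable hk).prod_right_ae, hk.1.prodMk_left] with x h1 h2
  exact (memLp_two_iff_integrable_sq h2).2 h1

theorem sq_integral_mul_le {g f : ℝ → ℝ} (hg : MemLp g 2 halfLine) (hf : MemLp f 2 halfLine) :
    (∫ y, g y * f y ∂halfLine) ^ 2 ≤ (∫ y, (g y) ^ 2 ∂halfLine) * ∫ y, (f y) ^ 2 ∂halfLine := by
  have key : ∀ c d : ℝ, 0 ≤ (∫ y, (g y) ^ 2 ∂halfLine) * (c * c)
      + 2 * (∫ y, g y * f y ∂halfLine) * (c * d) + (∫ y, (f y) ^ 2 ∂halfLine) * (d * d) := by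
    intro c d
    have h0 : 0 ≤ ∫ y, (c * g y + d * f y) ^ 2 ∂halfLine :=
      integral_nonneg fun y => sq_nonneg _
    have h1 : Integrable (fun y => (g y) ^ 2) halfLine := hg.integrable_sq
    have h2 : Integrable (fun y => (f y) ^ 2) halfLine := hf.integrable_sq
    have h3 : Integrable (fun y => g y * f y) halfLine := hg.integrable_mul hf
    have h4 : ∫ y, (c * g y + d * f y) ^ 2 ∂halfLine
        = ∫ y, ((c * c) * (g y) ^ 2 + (2 * (c * d)) * (g y * f y)) + (d * d) * (f y) ^ 2
            ∂halfLine := by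
      congr 1; ext y; ring
    have h5 : Integrable (fun y => (c * c) * (g y) ^ 2 + (2 * (c * d)) * (g y * f y)) halfLine :=
      (h1.const_mul _).add (h3.const_mul _)
    rw [h4, integral_add h5 (h2.const_mul _), integral_add (h1.const_mul _) (h3.const_mul _),
      integral_const_mul, integral_const_mul, integral_const_mul] at h0
    linarith
  have h := discrim_le_zero (a := ∫ y, (g y) ^ 2 ∂halfLine)
    (b := 2 * ∫ y, g y * f y ∂halfLine) (c := ∫ y, (f y) ^ 2 ∂halfLine)
    (fun x => by have := key x 1; linarith)
  unfold discrim at h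
  nlinarith

theorem sq_integral_row_le (hk : MemLp (Function.uncurry k) 2 (halfLine.prod halfLine))
    (f : L2) : ∀ᵐ x ∂halfLine, (∫ y, k x y * f y ∂halfLine) ^ 2
      ≤ (∫ y, (k x y) ^ 2 ∂halfLine) * ∫ y, (f y) ^ 2 ∂halfLine := by
  filter_upwards [row_memLp hk] with x hx
  exact sq_integral_mul_le hx (Lp.memLp f)

theorem integral_row_aestronglyMeasurable
    (hk : MemLp (Function.uncurry k) 2 (halfLine.prod halfLine)) (f : L2) :
    AEStronglyMeasurable (fun x => ∫ y, k x y * f y ∂halfLine) halfLine := by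
  have h : AEStronglyMeasurable (fun z : ℝ × ℝ => k z.1 z.2 * f z.2) (halfLine.prod halfLine) :=
    hk.1.mul (Lp.memLp f).1.comp_snd
  exact h.integral_prod_right'

theorem integral_row_memLp (hk : MemLp (Function.uncurry k) 2 (halfLine.prod halfLine))
    (f : L2) : MemLp (fun x => ∫ y, k x y * f y ∂halfLine) 2 halfLine := by
  have hm := integral_row_aestronglyMeasurable hk f
  refine (memLp_two_iff_integrable_sq hm).2 ?_
  refine Integrable.mono' ((sq_kernel_integrable hk).integral_prod_left.mul_const
    (∫ y, (f y) ^ 2 ∂halfLine)) (hm.pow 2) ?_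
  filter_upwards [sq_integral_row_le hk f] with x hx
  rw [Real.norm_of_nonneg (sq_nonneg _)]
  exact hx

theorem norm_sq_L2 (f : L2) : ‖f‖ ^ 2 = ∫ y, (f y) ^ 2 ∂halfLine := by
  rw [← real_inner_self_eq_norm_sq, L2.inner_def]
  congr 1; ext y; simp [sq]

/-- The linear map `f ↦ (x ↦ ∫ k(x,y) f(y) dy)` of a Hilbert-Schmidt kernel. -/
def integralLinearMap (k : ℝ → ℝ → ℝ)
    (hk : MemLp (Function.uncurry k) 2 (halfLine.prod halfLine)) : L2 →ₗ[ℝ] L2 where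
  toFun f := (integral_row_memLp hk f).toLp _
  map_add' f g := by
    rw [← MemLp.toLp_add, MemLp.toLp_eq_toLp_iff]
    filter_upwards [row_memLp hk] with x hx
    have h1 : ∫ y, k x y * (f + g) y ∂halfLine = ∫ y, (k x y * f y + k x y * g y) ∂halfLine := by
      refine integral_congr_ae ?_
      filter_upwards [Lp.coeFn_add f g] with y hy
      rw [hy, Pi.add_apply, mul_add]
    have hf : Integrable (fun y => k x y * f y) halfLine := hx.integrable_mul (Lp.memLp f)
    have hg : Integrable (fun y => k x y * g y) halfLine := hx.integrable_mul (Lp.memLp g)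
    rw [h1, integral_add hf hg]
    rfl
  map_smul' c f := by
    simp only [RingHom.id_apply]
    rw [← MemLp.toLp_const_smul, MemLp.toLp_eq_toLp_iff]
    filter_upwards with x
    have h1 : ∫ y, k x y * (c • f) y ∂halfLine = ∫ y, c * (k x y * f y) ∂halfLine := by
      refine integral_congr_ae ?_
      filter_upwards [Lp.coeFn_smul c f] with y hy
      rw [hy, Pi.smul_apply, smul_eq_mul]; ring
    rw [h1, integral_const_mul]
    rfl

theorem norm_integralLinearMap_le
    (hk : MemLp (Function.uncurry k) 2 (halfLine.prod halfLine)) (f : L2) :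
    ‖integralLinearMap k hk f‖
      ≤ Real.sqrt (∫ x, ∫ y, (k x y) ^ 2 ∂halfLine ∂halfLine) * ‖f‖ := by
  have hC : 0 ≤ ∫ x, ∫ y, (k x y) ^ 2 ∂halfLine ∂halfLine :=
    integral_nonneg fun x => integral_nonneg fun y => sq_nonneg _
  refine abs_le_of_sq_le_sq' ?_ (by positivity) |>.2
  rw [mul_pow, Real.sq_sqrt hC, norm_sq_L2 f, norm_sq_L2, ← integral_mul_const]
  have h0 : ∫ x, (integralLinearMap k hk f x) ^ 2 ∂halfLine
      = ∫ x, (∫ y, k x y * f y ∂halfLine) ^ 2 ∂halfLine := by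
    refine integral_congr_ae ?_
    filter_upwards [(integral_row_memLp hk f).coeFn_toLp] with x hx
    exact congrArg (· ^ 2) hx
  rw [h0]
  exact integral_mono_ae (integral_row_memLp hk f).integrable_sq
    ((sq_kernel_integrable hk).integral_prod_left.mul_const _) (sq_integral_row_le hk f)

end IntegralOperator

/-- The bounded operator on `L²(ℝ₊)` with a Hilbert-Schmidt kernel `k`, that is
`(T f)(x) = ∫_{ℝ₊} k(x,y) f(y) dy` (and `0` if `k` is not square integrable on `ℝ₊ × ℝ₊`). -/
def integralOperator (k : ℝ → ℝ → ℝ) : L2 →L[ℝ] L2 :=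
  open Classical in
  if hk : MemLp (Function.uncurry k) 2 (halfLine.prod halfLine) then
    (integralLinearMap k hk).mkContinuous _ (norm_integralLinearMap_le hk)
  else 0

theorem integralOperator_apply {k : ℝ → ℝ → ℝ}
    (hk : MemLp (Function.uncurry k) 2 (halfLine.prod halfLine)) (f : L2) :
    integralOperator k f =ᵐ[halfLine] fun x => ∫ y, k x y * f y ∂halfLine := by
  unfold integralOperator
  rw [dif_pos hk]
  exact (integral_row_memLp hk f).coeFn_toLp

/-- The kernel `A_s^{(p)}(t, y) = A^{(p)}(t + y + s)`. -/
def kernelA (A : ℝ → ℝ) (s : ℝ) (p : ℕ) (t y : ℝ) : ℝ := iteratedDeriv p A (t + y + s)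

/-- The operator `√σ A_s^{(p)} : L²(ℝ₊) → L²(ℝ)`, whose kernel is `√σ(r) A^{(p)}(r + y + s)`,
is Hilbert-Schmidt. -/
def IsWeightedHilbertSchmidt (A σ : ℝ → ℝ) (s : ℝ) (p : ℕ) : Prop :=
  Integrable (fun z : ℝ × ℝ => σ z.1 * (kernelA A s p z.1 z.2) ^ 2) (volume.prod halfLine)

/-- The kernel `K₂(x, y) = ∫_ℝ A_s(r, x) σ(r) A_s(r, y) dr` of `K₂ = A_sᵀ σ A_s`. -/
def kernelK2 (A σ : ℝ → ℝ) (s x y : ℝ) : ℝ := ∫ r, kernelA A s 0 r x * σ r * kernelA A s 0 r y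

/-- The operator `K₂ = A_sᵀ σ A_s` on `L²(ℝ₊)`. -/
def K2 (A σ : ℝ → ℝ) (s : ℝ) : L2 →L[ℝ] L2 := integralOperator (kernelK2 A σ s)

/-- `(I - K₂)⁻¹`, meaningful when `I - K₂` is invertible. -/
def resolvent (A σ : ℝ → ℝ) (s : ℝ) : L2 →L[ℝ] L2 := Ring.inverse (1 - K2 A σ s)

/-- The column-like function `q_p = A_s^{(p)} (I - K₂)⁻¹ |δ⟩`, where
`(I - K₂)⁻¹ |δ⟩ = |δ⟩ + (I - K₂)⁻¹ K₂ |δ⟩` and `K₂ |δ⟩` is the function `K₂(·, 0)`. -/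
def q (A σ : ℝ → ℝ) (s : ℝ) (p : ℕ) (t : ℝ) : ℝ :=
  kernelA A s p t 0 +
    ∫ y, kernelA A s p t y * resolvent A σ s (toL2 fun x => kernelK2 A σ s x 0) y ∂halfLine

/-- The matrix-like function `u_p = A_s^{(p)} (I - K₂)⁻¹ A_sᵀ`. -/
def u (A σ : ℝ → ℝ) (s : ℝ) (p : ℕ) (t t' : ℝ) : ℝ :=
  ∫ y, kernelA A s p t y * resolvent A σ s (toL2 (kernelA A s 0 t')) y ∂halfLine

/-- Transpose of a matrix-like function. -/
def transpose (M : ℝ → ℝ → ℝ) : ℝ → ℝ → ℝ := fun t t' => M t' t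

/-- The rank-one matrix-like function `a bᵀ`. -/
def outer (a b : ℝ → ℝ) : ℝ → ℝ → ℝ := fun t t' => a t * b t'

/-- The matrix-like product `M σ' N`, where `σ'` is the Lebesgue-Stieltjes measure of the
nondecreasing function `σ`: the density `σ'(v) dv` plus a Dirac mass at every jump. -/
def mulDeriv {σ : ℝ → ℝ} (hσ : Monotone σ) (M N : ℝ → ℝ → ℝ) : ℝ → ℝ → ℝ :=
  fun t t' => ∫ v, M t v * N v t' ∂hσ.stieltjesFunction.measure

/-- The symmetric quantity `I_n`. -/
def quantityI (A : ℝ → ℝ) {σ : ℝ → ℝ} (hσ : Monotone σ) (s : ℝ) (n : ℕ) : ℝ → ℝ → ℝ :=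
  u A σ s (2 * n + 1) + transpose (u A σ s (2 * n + 1)) +
    ∑ k ∈ Finset.range (2 * n + 1), (-1 : ℝ) ^ (k + 1) •
      (mulDeriv hσ (u A σ s (2 * n - k)) (transpose (u A σ s k)) -
        outer (q A σ s (2 * n - k)) (q A σ s k))

/-- The anti-symmetric quantity `J_n`. -/
def quantityJ (A : ℝ → ℝ) {σ : ℝ → ℝ} (hσ : Monotone σ) (s : ℝ) (n : ℕ) : ℝ → ℝ → ℝ :=
  u A σ s (2 * n) - transpose (u A σ s (2 * n)) +
    ∑ k ∈ Finset.range (2 * n), (-1 : ℝ) ^ (k + 1) •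
      (mulDeriv hσ (u A σ s (2 * n - 1 - k)) (transpose (u A σ s k)) -
        outer (q A σ s (2 * n - 1 - k)) (q A σ s k))

end InhomFredholm

end

/-! Put R = (I - K₂)⁻¹, a_j = A^{(j)}(t + · + s), b_k = A^{(k)}(t' + · + s) and U(j, k) = ⟨a_j, R
b_k⟩. Everything rests on the recursion U(j+1, k) + U(j, k+1) = (u_j σ' u_kᵀ - q_j q_kᵀ)(t, t')
(`inner_succ_add_inner_succ`). Its alternating sum along j + k = m telescopes to the end terms
U(m+1, 0) = u_{m+1}(t, t') and U(0, m+1) = u_{m+1}(t', t), the latter by symmetry of R. Even m gives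
I_n and odd m gives J_n.

The recursion is integration by parts, done twice (`integral_deriv_mul_add`). Let H = R a_j and G =
R b_k. Since H = a_j + K₂ H, differentiation gives H' = a_{j+1} + A_s^{(1)ᵀ} σ A_s H, and likewise
for G. Integrating (HG)' over ℝ₊ yields -H(0)G(0) = -q_j(t) q_k(t') on one side. On the other side
stand U(j+1, k) + U(j, k+1) and the integral of σ (A_s H · A_s G)' over ℝ. The latter equals -∫ A_s
H · A_s G dσ (`integral_weight_deriv_applyA`), and A_s H = u_j(t, ·), A_s G = u_k(t', ·).

Only one derivative ever falls on the kernel of K₂, so the weighted Hilbert-Schmidt conditions for p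
= 0, 1 suffice for all n. The higher derivatives enter only through single rows, which are square
integrable by exponential decay. -/

namespace InhomFredholm

/-! ### Integration by parts on half-lines, and Fubini against a distribution function -/

/-- If `f` and `f'` are integrable on `(a, ∞)` and `f` is a primitive of `f'`, then `∫ f' = -f(a)`. -/
theorem integral_Ioi_of_primitive {f f' : ℝ → ℝ} {a : ℝ}
    (hf : IntegrableOn f (Ioi a)) (hf' : IntegrableOn f' (Ioi a))
    (h : ∀ x, a ≤ x → ∫ z in a..x, f' z = f x - f a) :
    ∫ z in Ioi a, f' z = - f a := by
  have h1 : Tendsto (fun x => ∫ z in a..x, f' z) atTop (𝓝 (∫ z in Ioi a, f' z)) :=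
    intervalIntegral_tendsto_integral_Ioi a hf' tendsto_id
  have h2 : Tendsto f atTop (𝓝 ((∫ z in Ioi a, f' z) + f a)) := by
    refine (h1.add_const (f a)).congr' ?_
    filter_upwards [eventually_ge_atTop a] with x hx
    rw [h x hx]; ring
  have h3 : (∫ z in Ioi a, f' z) + f a = 0 := by
    -- A nonzero limit l would keep |f| above |l|/2 near infinity, against integrability on a ray of
    -- infinite length.
    by_contra hne
    set l := (∫ z in Ioi a, f' z) + f a
    have hl : 0 < ‖l‖ / 2 := by positivity
    have hev : ∀ᶠ x in atTop, ‖l‖ / 2 < ‖f x‖ :=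
      h2.norm.eventually (lt_mem_nhds (by linarith))
    obtain ⟨b, hb⟩ := eventually_atTop.1 hev
    have hint : IntegrableOn (fun _ : ℝ => ‖l‖ / 2) (Ioi (max a b)) := by
      refine Integrable.mono' (hf.mono_set (Ioi_subset_Ioi (le_max_left a b))).norm
        aestronglyMeasurable_const ?_
      filter_upwards [ae_restrict_mem measurableSet_Ioi] with x hx
      rw [Real.norm_of_nonneg hl.le]
      exact (hb x ((le_max_right a b).trans (le_of_lt hx))).le
    rw [integrableOn_const_iff] at hint
    simp only [Real.volume_Ioi, lt_self_iff_false, or_false] at hint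
    simp at hint
    exact hne hint
  linarith

theorem absolutelyContinuousOnInterval_const_add_integral {f : ℝ → ℝ} {a b c : ℝ}
    (hf : IntervalIntegrable f volume a b) :
    AbsolutelyContinuousOnInterval (fun x => c + ∫ z in a..x, f z) a b := by
  have h1 : AbsolutelyContinuousOnInterval (fun _ : ℝ => c) a b :=
    (LipschitzWith.const c).lipschitzOnWith.absolutelyContinuousOnInterval
  exact h1.add (hf.absolutelyContinuousOnInterval_intervalIntegral left_mem_uIcc)

theorem ae_deriv_const_add_integral {f : ℝ → ℝ} {a b c : ℝ}
    (hf : IntervalIntegrable f volume a b) :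
    ∀ᵐ x, x ∈ uIoc a b → deriv (fun x => c + ∫ z in a..x, f z) x = f x := by
  filter_upwards [hf.ae_hasDerivAt_integral] with x hx hxm
  exact ((hx (uIoc_subset_uIcc hxm) a left_mem_uIcc).const_add c).deriv

/-- Product rule on `(a, ∞)` for square-integrable primitives of square-integrable functions. -/
theorem integral_Ioi_mul_primitive {f g f' g' : ℝ → ℝ} {a : ℝ}
    (hf : MemLp f 2 (volume.restrict (Ioi a))) (hg : MemLp g 2 (volume.restrict (Ioi a)))
    (hf' : MemLp f' 2 (volume.restrict (Ioi a))) (hg' : MemLp g' 2 (volume.restrict (Ioi a)))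
    (hff' : ∀ x, a ≤ x → f x = f a + ∫ z in a..x, f' z)
    (hgg' : ∀ x, a ≤ x → g x = g a + ∫ z in a..x, g' z) :
    ∫ z in Ioi a, (f' z * g z + f z * g' z) = - (f a * g a) := by
  have hint : ∀ {w : ℝ → ℝ}, MemLp w 2 (volume.restrict (Ioi a)) → ∀ x, a ≤ x →
      IntervalIntegrable w volume a x := by
    intro w hw x hx
    rw [intervalIntegrable_iff_integrableOn_Ioc_of_le hx]
    have h1 : MemLp w 2 (volume.restrict (Ioc a x)) :=
      hw.mono_measure (Measure.restrict_mono Ioc_subset_Ioi_self le_rfl)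
    exact h1.integrable (by norm_num)
  refine integral_Ioi_of_primitive (f := fun x => f x * g x) (hf.integrable_mul hg)
    ((hf'.integrable_mul hg).add (hf.integrable_mul hg')) fun x hx => ?_
  have hF := hint hf' x hx
  have hG := hint hg' x hx
  -- The product rule is applied to the explicit primitives, which are absolutely continuous and
  -- agree with f and g to the right of a. Their derivatives are needed only almost everywhere.
  have key := AbsolutelyContinuousOnInterval.integral_deriv_mul_eq_sub
    (absolutelyContinuousOnInterval_const_add_integral (c := f a) hF)
    (absolutelyContinuousOnInterval_const_add_integral (c := g a) hG)
  simp only [intervalIntegral.integral_same, add_zero] at key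
  rw [← hff' x hx, ← hgg' x hx] at key
  rw [← key]
  refine intervalIntegral.integral_congr_ae ?_
  filter_upwards [ae_deriv_const_add_integral (c := f a) hF,
    ae_deriv_const_add_integral (c := g a) hG] with z h1 h2 hz
  have hz' : a ≤ z := by
    rw [uIoc_of_le hx] at hz; exact hz.1.le
  rw [h1 hz, h2 hz, ← hff' z hz', ← hgg' z hz']

/-- Fubini's theorem for a function whose weight `σ` is the distribution function of `μ`. -/
theorem integral_integral_Ioi_of_measure_Iio {μ : Measure ℝ} [SFinite μ] {σ w : ℝ → ℝ}
    (hσ : Measurable σ) (hσ0 : ∀ r, 0 ≤ σ r)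
    (hμ : ∀ᵐ r, μ (Iio r) = ENNReal.ofReal (σ r))
    (hwm : AEStronglyMeasurable w volume)
    (hw : Integrable w (volume.withDensity fun r => ENNReal.ofReal (σ r))) :
    Integrable (fun v => ∫ r in Ioi v, w r) μ ∧
      ∫ v, (∫ r in Ioi v, w r) ∂μ
        = ∫ r, w r ∂(volume.withDensity fun r => ENNReal.ofReal (σ r)) := by
  have hm : Measurable fun r => ENNReal.ofReal (σ r) := hσ.ennreal_ofReal
  have hlt : ∀ᵐ r : ℝ, ENNReal.ofReal (σ r) < ⊤ := by simp
  rw [integrable_withDensity_iff_integrable_smul' hm hlt] at hw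
  rw [integral_withDensity_eq_integral_toReal_smul hm hlt]
  simp only [ENNReal.toReal_ofReal (hσ0 _), smul_eq_mul] at hw ⊢
  -- F is w(r) on v < r. Integrating in v first gives σ(r) w(r), whose integrability is assumed;
  -- integrating in r first gives the tail of w. Integrability of the tails against μ is therefore a
  -- by-product.
  set F : ℝ × ℝ → ℝ := {z : ℝ × ℝ | z.1 < z.2}.indicator fun z => w z.2 with hFdef
  have hFm : AEStronglyMeasurable F (μ.prod volume) :=
    (hwm.comp_snd).indicator (measurableSet_lt measurable_fst measurable_snd)
  have e1 : ∀ v r, F (v, r) = (Iio r).indicator (fun _ => w r) v := by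
    intro v r; simp [F, indicator]
  have e2 : ∀ v r, F (v, r) = (Ioi v).indicator w r := by
    intro v r; simp [F, indicator]
  have hF : Integrable F (μ.prod volume) := by
    rw [integrable_prod_iff' hFm]
    constructor
    · filter_upwards [hμ] with r hr
      simp only [e1]
      rw [integrable_indicator_iff measurableSet_Iio, integrableOn_const_iff]
      right; rw [hr]; simp
    · refine hw.norm.congr ?_
      filter_upwards [hμ] with r hr
      simp only [e1, norm_indicator_eq_indicator_norm]
      rw [integral_indicator measurableSet_Iio, setIntegral_const, Measure.real, hr,
        ENNReal.toReal_ofReal (hσ0 r), norm_mul, Real.norm_of_nonneg (hσ0 r), smul_eq_mul]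
  have e3 : ∀ v, ∫ r, F (v, r) = ∫ r in Ioi v, w r := by
    intro v; simp only [e2]; rw [integral_indicator measurableSet_Ioi]
  refine ⟨?_, ?_⟩
  · have := hF.integral_prod_left
    simpa only [e3] using this
  · have h1 := integral_integral_swap (f := fun v r => F (v, r)) hF
    simp only [e3] at h1
    rw [h1]
    refine integral_congr_ae ?_
    filter_upwards [hμ] with r hr
    simp only [e1]
    rw [integral_indicator measurableSet_Iio, setIntegral_const, Measure.real, hr,
        ENNReal.toReal_ofReal (hσ0 r), smul_eq_mul]

/-! ### Hilbert-Schmidt kernels between general measures -/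

theorem integral_mul_sq_le {μ : Measure ℝ} {c g : ℝ → ℝ} (hc : MemLp c 2 μ) (hg : MemLp g 2 μ) :
    (∫ x, c x * g x ∂μ) ^ 2 ≤ (∫ x, c x ^ 2 ∂μ) * ∫ x, g x ^ 2 ∂μ := by
  have h := real_inner_mul_inner_self_le (hc.toLp c) (hg.toLp g)
  have e : ∀ {f₁ f₂ : ℝ → ℝ} (h₁ : MemLp f₁ 2 μ) (h₂ : MemLp f₂ 2 μ),
      inner ℝ (h₁.toLp f₁) (h₂.toLp f₂) = ∫ x, f₁ x * f₂ x ∂μ := by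
    intro f₁ f₂ h₁ h₂
    rw [MeasureTheory.L2.inner_def]
    refine integral_congr_ae ?_
    filter_upwards [h₁.coeFn_toLp, h₂.coeFn_toLp] with x hx1 hx2
    rw [hx1, hx2]; simp [mul_comm]
  rw [e, e, e] at h
  simpa only [sq] using h

theorem memLp_mul_prod {μ κ : Measure ℝ} {c g : ℝ → ℝ} (hc : MemLp c 2 μ) (hg : MemLp g 2 κ) :
    MemLp (fun z : ℝ × ℝ => c z.1 * g z.2) 2 (μ.prod κ) := by
  have hm : AEStronglyMeasurable (fun z : ℝ × ℝ => c z.1 * g z.2) (μ.prod κ) :=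
    hc.1.comp_fst.mul hg.1.comp_snd
  rw [memLp_two_iff_integrable_sq hm]
  simpa only [mul_pow] using hc.integrable_sq.mul_prod hg.integrable_sq

theorem aestronglyMeasurable_integral_kernel {μ κ : Measure ℝ} [SFinite κ]
    {B : ℝ → ℝ → ℝ} {g : ℝ → ℝ}
    (hB : AEStronglyMeasurable (Function.uncurry B) (μ.prod κ)) (hg : AEStronglyMeasurable g κ) :
    AEStronglyMeasurable (fun x => ∫ y, B x y * g y ∂κ) μ :=
  (hB.mul hg.comp_snd).integral_prod_right'

theorem integrable_kernel_mul_mul {μ κ : Measure ℝ} {B : ℝ → ℝ → ℝ} {c g : ℝ → ℝ}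
    (hB : MemLp (Function.uncurry B) 2 (μ.prod κ))
    (hc : MemLp c 2 μ) (hg : MemLp g 2 κ) :
    Integrable (fun z : ℝ × ℝ => B z.1 z.2 * (c z.1 * g z.2)) (μ.prod κ) :=
  hB.integrable_mul (memLp_mul_prod hc hg)

section Kernel

variable {μ κ : Measure ℝ} [SFinite μ] [SFinite κ] {B C : ℝ → ℝ → ℝ} {c g : ℝ → ℝ}

/-- The adjoint of an integral operator has the transposed kernel. -/
theorem integral_mul_integral_kernel_swap (hB : MemLp (Function.uncurry B) 2 (μ.prod κ))
    (hc : MemLp c 2 μ) (hg : MemLp g 2 κ) :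
    ∫ x, c x * (∫ y, B x y * g y ∂κ) ∂μ = ∫ y, (∫ x, B x y * c x ∂μ) * g y ∂κ := by
  have h := integral_integral_swap (f := fun x y => B x y * (c x * g y))
    (integrable_kernel_mul_mul hB hc hg)
  have e1 : ∀ x, c x * (∫ y, B x y * g y ∂κ) = ∫ y, B x y * (c x * g y) ∂κ := fun x => by
    rw [← integral_const_mul]; congr 1; ext y; ring
  have e2 : ∀ y, (∫ x, B x y * c x ∂μ) * g y = ∫ x, B x y * (c x * g y) ∂μ := fun y => by
    rw [← integral_mul_const]; congr 1; ext x; ring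
  simp only [e1, e2]
  exact h

theorem memLp_two_swap (hB : MemLp (Function.uncurry B) 2 (μ.prod κ)) :
    MemLp (Function.uncurry fun y x => B x y) 2 (κ.prod μ) :=
  hB.comp_measurePreserving Measure.measurePreserving_swap

theorem ae_memLp_kernel_left (hB : MemLp (Function.uncurry B) 2 (μ.prod κ)) :
    ∀ᵐ x ∂μ, MemLp (B x) 2 κ := by
  filter_upwards [hB.integrable_sq.prod_right_ae, hB.1.prodMk_left] with x h1 h2
  exact (memLp_two_iff_integrable_sq h2).2 h1

theorem memLp_integral_kernel (hB : MemLp (Function.uncurry B) 2 (μ.prod κ)) (hg : MemLp g 2 κ) :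
    MemLp (fun x => ∫ y, B x y * g y ∂κ) 2 μ := by
  have hm := aestronglyMeasurable_integral_kernel hB.1 hg.1
  refine (memLp_two_iff_integrable_sq hm).2 ?_
  refine Integrable.mono' (hB.integrable_sq.integral_prod_left.mul_const (∫ y, (g y) ^ 2 ∂κ))
    (hm.pow 2) ?_
  filter_upwards [ae_memLp_kernel_left hB] with x hx
  rw [Real.norm_of_nonneg (sq_nonneg _)]
  exact integral_mul_sq_le hx hg

/-- The kernel of `Bᵀ C` is square integrable. -/
theorem memLp_integral_kernel_mul_kernel {κ' : Measure ℝ} [SFinite κ']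
    (hB : MemLp (Function.uncurry B) 2 (μ.prod κ)) (hC : MemLp (Function.uncurry C) 2 (μ.prod κ'))
    (hBm : Measurable (Function.uncurry B)) (hCm : Measurable (Function.uncurry C)) :
    MemLp (Function.uncurry fun x y => ∫ r, B r x * C r y ∂μ) 2 (κ.prod κ') := by
  have hm : AEStronglyMeasurable (Function.uncurry fun x y => ∫ r, B r x * C r y ∂μ)
      (κ.prod κ') := by
    have h : Measurable fun z : (ℝ × ℝ) × ℝ => B z.2 z.1.1 * C z.2 z.1.2 :=
      (hBm.comp (measurable_snd.prodMk measurable_fst.fst)).mul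
        (hCm.comp (measurable_snd.prodMk measurable_fst.snd))
    exact h.stronglyMeasurable.integral_prod_right'.aestronglyMeasurable
  refine (memLp_two_iff_integrable_sq hm).2 ?_
  have hb : Integrable (fun x => ∫ r, B r x ^ 2 ∂μ) κ := hB.integrable_sq.integral_prod_right
  have hc : Integrable (fun x => ∫ r, C r x ^ 2 ∂μ) κ' := hC.integrable_sq.integral_prod_right
  refine Integrable.mono' (hb.mul_prod hc) (hm.pow 2) ?_
  have h1 := Measure.quasiMeasurePreserving_fst (μ := κ) (ν := κ') |>.ae
    (ae_memLp_kernel_left (memLp_two_swap hB))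
  have h2 := Measure.quasiMeasurePreserving_snd (μ := κ) (ν := κ') |>.ae
    (ae_memLp_kernel_left (memLp_two_swap hC))
  filter_upwards [h1, h2] with z hz1 hz2
  rw [Real.norm_of_nonneg (sq_nonneg _)]
  exact integral_mul_sq_le hz1 hz2

end Kernel

/-! ### Smoothness and decay of the kernels A^{(p)}(t + y + s) -/

section KernelA

variable {A : ℝ → ℝ} {s : ℝ}

theorem kernelA_comm (p : ℕ) (t y : ℝ) : kernelA A s p t y = kernelA A s p y t := by
  simp only [kernelA, add_comm t y]

theorem continuous_kernelA (hA : ContDiff ℝ ∞ A) (p : ℕ) :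
    Continuous (Function.uncurry (kernelA A s p)) := by
  have h : Continuous (iteratedDeriv p A) := hA.continuous_iteratedDeriv p (by exact_mod_cast le_top)
  exact h.comp ((continuous_fst.add continuous_snd).add continuous_const)

theorem hasDerivAt_kernelA (hA : ContDiff ℝ ∞ A) (p : ℕ) (z y : ℝ) :
    HasDerivAt (fun z => kernelA A s p z y) (kernelA A s (p + 1) z y) z := by
  have h : DifferentiableAt ℝ (iteratedDeriv p A) (z + y + s) :=
    (hA.differentiable_iteratedDeriv p (by exact_mod_cast ENat.natCast_lt_top p)) _
  have h2 : HasDerivAt (fun z : ℝ => z + y + s) 1 z := ((hasDerivAt_id z).add_const y).add_const s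
  have h3 := h.hasDerivAt.comp z h2
  rw [← iteratedDeriv_succ, mul_one] at h3
  exact h3

theorem integral_kernelA_succ (hA : ContDiff ℝ ∞ A) (p : ℕ) (a x y : ℝ) :
    ∫ z in a..x, kernelA A s (p + 1) z y = kernelA A s p x y - kernelA A s p a y := by
  refine intervalIntegral.integral_eq_sub_of_hasDerivAt
    (fun z _ => hasDerivAt_kernelA hA p z y) ?_
  exact ((continuous_kernelA hA (p + 1)).comp
    (continuous_id.prodMk continuous_const)).intervalIntegrable _ _

/-- `x ↦ ∫ A^{(p)}(x + r + s) c(r) dκ(r)` is a primitive of the same function for `p + 1`. -/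
theorem integral_kernelA_mul_eq_add (hA : ContDiff ℝ ∞ A) {κ : Measure ℝ} [SFinite κ] {p : ℕ}
    {c : ℝ → ℝ} {a x : ℝ}
    (hB : MemLp (Function.uncurry (kernelA A s (p + 1))) 2 ((volume.restrict (Ioi a)).prod κ))
    (hc : MemLp c 2 κ) (h0 : Integrable (fun r => kernelA A s p a r * c r) κ) (hx : a ≤ x) :
    ∫ r, kernelA A s p x r * c r ∂κ
      = ∫ r, kernelA A s p a r * c r ∂κ
        + ∫ z in a..x, ∫ r, kernelA A s (p + 1) z r * c r ∂κ := by
  have hle : (volume.restrict (Ioc a x)).prod κ ≤ (volume.restrict (Ioi a)).prod κ :=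
    Measure.prod_mono (Measure.restrict_mono Ioc_subset_Ioi_self le_rfl) le_rfl
  have h1 : MemLp (fun _ : ℝ => (1 : ℝ)) 2 (volume.restrict (Ioc a x)) := memLp_const 1
  have hint := integrable_kernel_mul_mul (hB.mono_measure hle) h1 hc
  simp only [one_mul] at hint
  have e : ∀ r, ∫ z in Ioc a x, kernelA A s (p + 1) z r * c r
      = kernelA A s p x r * c r - kernelA A s p a r * c r := fun r => by
    rw [integral_mul_const, ← intervalIntegral.integral_of_le hx, integral_kernelA_succ hA, sub_mul]
  have hswap := integral_integral_swap (f := fun z r => kernelA A s (p + 1) z r * c r) hint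
  have hr := hint.integral_prod_right
  simp only [e] at hswap hr
  rw [intervalIntegral.integral_of_le hx, hswap, ← integral_add h0 hr]
  congr 1; ext r; ring

theorem exists_exp_bound {f : ℝ → ℝ} (hf : Continuous f) {c : ℝ}
    (ho : f =O[atTop] fun x : ℝ => Real.exp (-c * x)) (a : ℝ) :
    ∃ C : ℝ, 0 ≤ C ∧ ∀ x, a ≤ x → |f x| ≤ C * Real.exp (-c * x) := by
  obtain ⟨C, hC⟩ := ho.bound
  obtain ⟨b, hb⟩ := eventually_atTop.1 hC
  have hcont : Continuous fun x => f x * Real.exp (c * x) := by fun_prop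
  obtain ⟨M, hM⟩ := (isCompact_Icc (a := a) (b := b)).exists_bound_of_continuousOn
    hcont.continuousOn
  refine ⟨max (max C M) 0, le_max_right _ _, fun x hx => ?_⟩
  rcases le_total b x with h | h
  · have h1 := hb x h
    simp only [Real.norm_eq_abs, Real.abs_exp] at h1
    exact h1.trans (by gcongr; exact (le_max_left _ _).trans (le_max_left _ _))
  · have h1 := hM x ⟨hx, h⟩
    rw [norm_mul, Real.norm_eq_abs, Real.norm_eq_abs, Real.abs_exp] at h1
    have h2 : |f x| = |f x| * Real.exp (c * x) * Real.exp (-c * x) := by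
      rw [mul_assoc, ← Real.exp_add]; simp
    rw [h2]
    gcongr
    exact h1.trans ((le_max_right _ _).trans (le_max_left _ _))

theorem memLp_exp_neg {c : ℝ} (hc : 0 < c) (a : ℝ) :
    MemLp (fun y : ℝ => Real.exp (-c * y)) 2 (volume.restrict (Ioi a)) := by
  have hm : Continuous fun y : ℝ => Real.exp (-c * y) := by fun_prop
  rw [memLp_two_iff_integrable_sq hm.aestronglyMeasurable]
  refine (exp_neg_integrableOn_Ioi a (by positivity : 0 < 2 * c)).congr ?_
  refine Eventually.of_forall fun y => ?_
  simp only [sq, ← Real.exp_add]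
  congr 1; ring

variable (hA : ContDiff ℝ ∞ A)
  (hA_decay : ∀ p : ℕ, ∃ c : ℝ, 0 < c ∧
      iteratedDeriv p A =O[atTop] fun x : ℝ => Real.exp (-c * x))

include hA hA_decay

/-- On t > v, y > 0 the argument stays above v + s, so the exponential bound applies and factorises
in t and y. This is the unweighted bound used to integrate by parts on (v, ∞), where σ plays no
role. -/
theorem memLp_kernelA_prod_halfLine (p : ℕ) (v : ℝ) :
    MemLp (Function.uncurry (kernelA A s p)) 2 ((volume.restrict (Ioi v)).prod halfLine) := by
  obtain ⟨c, hc, ho⟩ := hA_decay p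
  obtain ⟨C, hC0, hC⟩ := exists_exp_bound
    (hA.continuous_iteratedDeriv p (by exact_mod_cast le_top)) ho (v + s)
  refine ((memLp_mul_prod (memLp_exp_neg hc v) (memLp_exp_neg hc 0)).const_mul
    (C * Real.exp (-c * s))).of_le (continuous_kernelA hA p).aestronglyMeasurable ?_
  have h1 := (Measure.quasiMeasurePreserving_fst (μ := volume.restrict (Ioi v))
    (ν := halfLine)).ae (ae_restrict_mem measurableSet_Ioi)
  have h2 := (Measure.quasiMeasurePreserving_snd (μ := volume.restrict (Ioi v))
    (ν := halfLine)).ae (ae_restrict_mem measurableSet_Ioi)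
  filter_upwards [h1, h2] with z hz1 hz2
  have hz1' : v < z.1 := hz1
  have hz2' : 0 < z.2 := hz2
  rw [Real.norm_of_nonneg (by positivity : (0:ℝ) ≤
    C * Real.exp (-c * s) * (Real.exp (-c * z.1) * Real.exp (-c * z.2)))]
  refine (hC (z.1 + z.2 + s) (by linarith)).trans (le_of_eq ?_)
  rw [mul_assoc, ← Real.exp_add, ← Real.exp_add]
  congr 2; ring

theorem memLp_kernelA_row (p : ℕ) (t : ℝ) : MemLp (kernelA A s p t) 2 halfLine := by
  obtain ⟨c, hc, ho⟩ := hA_decay p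
  obtain ⟨C, hC0, hC⟩ := exists_exp_bound
    (hA.continuous_iteratedDeriv p (by exact_mod_cast le_top)) ho (t + s)
  refine ((memLp_exp_neg hc 0).const_mul (C * Real.exp (-c * (t + s)))).of_le
    ((continuous_kernelA hA p).comp (Continuous.prodMk_right t)).aestronglyMeasurable ?_
  filter_upwards [ae_restrict_mem measurableSet_Ioi] with y hy
  have hy' : 0 < y := hy
  rw [Real.norm_of_nonneg (by positivity : (0:ℝ) ≤
    C * Real.exp (-c * (t + s)) * Real.exp (-c * y))]
  refine (hC (t + y + s) (by linarith)).trans (le_of_eq ?_)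
  rw [mul_assoc, ← Real.exp_add]
  congr 2; ring

end KernelA

/-! ### The weight σ(r) dr, symmetry of the resolvent, and integration by parts against σ -/

/-- The function `r ↦ ∫_{ℝ₊} A^{(p)}(r + y + s) g(y) dy`. -/
noncomputable def applyA (A : ℝ → ℝ) (s : ℝ) (p : ℕ) (g : ℝ → ℝ) (r : ℝ) : ℝ :=
  ∫ y, kernelA A s p r y * g y ∂halfLine

/-- The measure `σ(r) dr`. -/
noncomputable abbrev weight (σ : ℝ → ℝ) : Measure ℝ :=
  volume.withDensity fun r => ENNReal.ofReal (σ r)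

/-- The standing assumptions on `A`, `σ` and `s`. -/
structure Admissible (A σ : ℝ → ℝ) (s : ℝ) : Prop where
  contDiff : ContDiff ℝ ∞ A
  decay : ∀ p : ℕ, ∃ c : ℝ, 0 < c ∧ iteratedDeriv p A =O[atTop] fun x : ℝ => Real.exp (-c * x)
  mono : Monotone σ
  tendsto_bot : Tendsto σ atBot (𝓝 0)
  hilbertSchmidt_zero : IsWeightedHilbertSchmidt A σ s 0
  hilbertSchmidt_one : IsWeightedHilbertSchmidt A σ s 1

theorem resolvent_apply {A σ : ℝ → ℝ} {s : ℝ} (hinv : IsUnit (1 - K2 A σ s)) (f : L2) :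
    resolvent A σ s f = f + K2 A σ s (resolvent A σ s f) := by
  have h1 := congrArg (fun T : L2 →L[ℝ] L2 => T f) (Ring.mul_inverse_cancel _ hinv)
  have h2 : resolvent A σ s f - K2 A σ s (resolvent A σ s f) = f := h1
  exact (sub_eq_iff_eq_add.1 h2)

/-- The measure of (-∞, r) is the left limit of the right-continuous version of σ. It can differ
from σ(r) only at a jump, and jumps are countable, hence Lebesgue-null. -/
theorem measure_stieltjes_Iio_ae {σ : ℝ → ℝ} (hσ : Monotone σ) (hbot : Tendsto σ atBot (𝓝 0)) :
    ∀ᵐ r, hσ.stieltjesFunction.measure (Iio r) = ENNReal.ofReal (σ r) := by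
  have hlim : Tendsto hσ.stieltjesFunction atBot (𝓝 0) := tendsto_rightLim_atBot_of_tendsto hbot
  filter_upwards [hσ.countable_not_continuousAt.ae_notMem volume] with r hr
  have hc : ContinuousAt σ r := not_not.1 hr
  have e : Function.leftLim hσ.stieltjesFunction r = σ r :=
    (leftLim_rightLim (hσ.tendsto_leftLim r)).trans hc.continuousWithinAt.leftLim_eq
  rw [StieltjesFunction.measure_Iio _ hlim, e, sub_zero]

namespace Admissible

variable {A σ : ℝ → ℝ} {s : ℝ} (h : Admissible A σ s)

include h

theorem nonneg (r : ℝ) : 0 ≤ σ r := h.mono.le_of_tendsto h.tendsto_bot r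

theorem integral_weight (f : ℝ → ℝ) : ∫ r, f r ∂(weight σ) = ∫ r, σ r * f r := by
  rw [integral_withDensity_eq_integral_toReal_smul h.mono.measurable.ennreal_ofReal (by simp)]
  simp only [ENNReal.toReal_ofReal (h.nonneg _), smul_eq_mul]

theorem kernelK2_eq (x y : ℝ) :
    kernelK2 A σ s x y = ∫ r, kernelA A s 0 r x * kernelA A s 0 r y ∂(weight σ) := by
  rw [h.integral_weight, kernelK2]
  congr 1; ext r; ring

theorem memLp_kernelA_of_isWeightedHilbertSchmidt {p : ℕ}
    (hp : IsWeightedHilbertSchmidt A σ s p) :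
    MemLp (Function.uncurry (kernelA A s p)) 2 ((weight σ).prod halfLine) := by
  have hm : Measurable fun z : ℝ × ℝ => ENNReal.ofReal (σ z.1) :=
    h.mono.measurable.ennreal_ofReal.comp measurable_fst
  rw [memLp_two_iff_integrable_sq (continuous_kernelA h.contDiff p).aestronglyMeasurable, weight,
    prod_withDensity_left h.mono.measurable.ennreal_ofReal,
    integrable_withDensity_iff_integrable_smul' hm (by simp)]
  simp only [ENNReal.toReal_ofReal (h.nonneg _), smul_eq_mul]
  exact hp

theorem memLp_kernelA_zero :
    MemLp (Function.uncurry (kernelA A s 0)) 2 ((weight σ).prod halfLine) :=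
  h.memLp_kernelA_of_isWeightedHilbertSchmidt h.hilbertSchmidt_zero

theorem memLp_kernelA_one :
    MemLp (Function.uncurry (kernelA A s 1)) 2 ((weight σ).prod halfLine) :=
  h.memLp_kernelA_of_isWeightedHilbertSchmidt h.hilbertSchmidt_one

theorem memLp_kernelA_zero_swap :
    MemLp (Function.uncurry (kernelA A s 0)) 2 (halfLine.prod (weight σ)) := by
  have := memLp_two_swap h.memLp_kernelA_zero
  simpa only [kernelA_comm] using this

theorem memLp_kernelA_one_swap :
    MemLp (Function.uncurry (kernelA A s 1)) 2 (halfLine.prod (weight σ)) := by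
  have := memLp_two_swap h.memLp_kernelA_one
  simp_rw [fun y x => kernelA_comm (A := A) (s := s) 1 x y] at this
  exact this

theorem memLp_applyA_zero (g : L2) : MemLp (applyA A s 0 g) 2 (weight σ) :=
  memLp_integral_kernel h.memLp_kernelA_zero (Lp.memLp g)

theorem memLp_applyA_one (g : L2) : MemLp (applyA A s 1 g) 2 (weight σ) :=
  memLp_integral_kernel h.memLp_kernelA_one (Lp.memLp g)

theorem memLp_applyA_Ioi (p : ℕ) (v : ℝ) (g : L2) :
    MemLp (applyA A s p g) 2 (volume.restrict (Ioi v)) :=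
  memLp_integral_kernel (memLp_kernelA_prod_halfLine h.contDiff h.decay p v) (Lp.memLp g)

/-- The boundary row `A(· + s)` is square integrable for `σ(r) dr`. -/
theorem memLp_kernelA_boundary : MemLp (kernelA A s 0 0) 2 (weight σ) := by
  have : NeZero halfLine := ⟨by simp [Measure.restrict_eq_zero]⟩
  -- Square integrability in r is known only for almost every row, which says nothing about the row
  -- at 0. A good row y > 0 is moved to 0 by A(r + s) = A(y + r + s) - ∫₀^y A'(z + r + s) dz. The
  -- integral is the p = 1 operator applied to the indicator of (0, y].
  obtain ⟨y, hyLp, hy⟩ := ((ae_memLp_kernel_left h.memLp_kernelA_zero_swap).and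
    (ae_restrict_mem measurableSet_Ioi)).exists
  have hy' : 0 ≤ y := le_of_lt hy
  have hind : MemLp ((Ioc 0 y).indicator fun _ => (1 : ℝ)) 2 halfLine :=
    memLp_indicator_const 2 measurableSet_Ioc 1
      (Or.inr (ne_top_of_le_ne_top (by simp) (Measure.restrict_apply_le _ _)))
  have hsub := hyLp.sub (memLp_integral_kernel h.memLp_kernelA_one hind)
  refine (memLp_congr_ae (Eventually.of_forall fun r => ?_)).1 hsub
  have e : ∫ z, kernelA A s 1 r z * (Ioc 0 y).indicator (fun _ => (1 : ℝ)) z ∂halfLine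
      = ∫ z in (0 : ℝ)..y, kernelA A s (0 + 1) z r := by
    rw [intervalIntegral.integral_of_le hy', zero_add]
    have e' : ∀ z, kernelA A s 1 r z * (Ioc 0 y).indicator (fun _ => (1 : ℝ)) z
        = (Ioc 0 y).indicator (fun z => kernelA A s 1 z r) z := fun z => by
      by_cases hz : z ∈ Ioc 0 y <;> simp [hz, kernelA_comm 1 r z]
    simp only [e']
    rw [integral_indicator measurableSet_Ioc, Measure.restrict_restrict measurableSet_Ioc,
      inter_eq_left.2 Ioc_subset_Ioi_self]
  rw [Pi.sub_apply, e, integral_kernelA_succ h.contDiff]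
  ring

theorem memLp_kernelK2 :
    MemLp (Function.uncurry (kernelK2 A σ s)) 2 (halfLine.prod halfLine) := by
  have hm := (continuous_kernelA (s := s) h.contDiff 0).measurable
  have := memLp_integral_kernel_mul_kernel h.memLp_kernelA_zero h.memLp_kernelA_zero hm hm
  simpa only [← h.kernelK2_eq] using this

theorem K2_apply (g : L2) :
    K2 A σ s g =ᵐ[halfLine] fun x => ∫ r, kernelA A s 0 x r * applyA A s 0 g r ∂(weight σ) := by
  filter_upwards [integralOperator_apply h.memLp_kernelK2 g,
    ae_memLp_kernel_left h.memLp_kernelA_zero_swap] with x hx hxm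
  rw [K2, hx]
  have := integral_mul_integral_kernel_swap h.memLp_kernelA_zero hxm (Lp.memLp g)
  refine Eq.trans ?_ this.symm
  congr 1; ext y
  rw [h.kernelK2_eq]
  congr 2; ext r
  rw [kernelA_comm 0 r x]; ring

theorem inner_K2 (f g : L2) :
    inner ℝ f (K2 A σ s g) = ∫ r, applyA A s 0 f r * applyA A s 0 g r ∂(weight σ) := by
  have := integral_mul_integral_kernel_swap h.memLp_kernelA_zero (h.memLp_applyA_zero g)
    (Lp.memLp f)
  rw [MeasureTheory.L2.inner_def]
  calc _ = ∫ y, (∫ r, kernelA A s 0 r y * applyA A s 0 g r ∂(weight σ)) * f y ∂halfLine := by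
        refine integral_congr_ae ?_
        filter_upwards [h.K2_apply g] with y hy
        simp only [hy, kernelA_comm 0 y]
        simp
    _ = _ := by
        rw [← this]; congr 1; ext r; rw [mul_comm]; rfl

/-- The form ⟨f, K₂ g⟩ = ∫ σ (A_s f)(A_s g) is symmetric, so I - K₂ and its inverse are
self-adjoint. -/
theorem inner_resolvent (hinv : IsUnit (1 - K2 A σ s)) (f g : L2) :
    inner ℝ f (resolvent A σ s g) = inner ℝ (resolvent A σ s f) g := by
  have h1 := h.inner_K2 (resolvent A σ s f) (resolvent A σ s g)
  have h2 := h.inner_K2 (resolvent A σ s g) (resolvent A σ s f)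
  have h3 : inner ℝ (K2 A σ s (resolvent A σ s f)) (resolvent A σ s g)
      = inner ℝ (resolvent A σ s f) (K2 A σ s (resolvent A σ s g)) := by
    rw [real_inner_comm, h1, h2]
    congr 1; ext r; ring
  have hf := eq_sub_of_add_eq (resolvent_apply hinv f).symm
  have hg := eq_sub_of_add_eq (resolvent_apply hinv g).symm
  calc inner ℝ f (resolvent A σ s g)
      = inner ℝ (resolvent A σ s f - K2 A σ s (resolvent A σ s f)) (resolvent A σ s g) := by
        rw [← hf]
    _ = inner ℝ (resolvent A σ s f) (resolvent A σ s g - K2 A σ s (resolvent A σ s g)) := by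
        rw [inner_sub_left, h3, ← inner_sub_right]
    _ = inner ℝ (resolvent A σ s f) g := by rw [← hg]

theorem applyA_zero_eq_add (g : L2) {v x : ℝ} (hx : v ≤ x) :
    applyA A s 0 g x = applyA A s 0 g v + ∫ z in v..x, applyA A s 1 g z :=
  integral_kernelA_mul_eq_add h.contDiff
    (memLp_kernelA_prod_halfLine h.contDiff h.decay 1 v) (Lp.memLp g)
    ((memLp_kernelA_row h.contDiff h.decay 0 v).integrable_mul (Lp.memLp g)) hx

theorem aestronglyMeasurable_applyA (p : ℕ) (g : L2) :
    AEStronglyMeasurable (applyA A s p g) volume :=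
  aestronglyMeasurable_integral_kernel (continuous_kernelA h.contDiff p).aestronglyMeasurable
    (Lp.memLp g).1

/-- Integration by parts against the weight `σ`. -/
theorem integral_weight_deriv_applyA (f g : L2) :
    Integrable (fun v => applyA A s 0 f v * applyA A s 0 g v) h.mono.stieltjesFunction.measure ∧
      ∫ r, (applyA A s 1 f r * applyA A s 0 g r + applyA A s 0 f r * applyA A s 1 g r) ∂(weight σ)
        = - ∫ v, applyA A s 0 f v * applyA A s 0 g v ∂h.mono.stieltjesFunction.measure := by
  -- The derivative of the product is integrated only over (v, ∞), and Fubini then integrates in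
  -- dσ(v). No boundary term at -∞ and no continuity of σ is needed.
  have e : ∀ v, ∫ r in Ioi v, (applyA A s 1 f r * applyA A s 0 g r
      + applyA A s 0 f r * applyA A s 1 g r) = -(applyA A s 0 f v * applyA A s 0 g v) := fun v =>
    integral_Ioi_mul_primitive (h.memLp_applyA_Ioi 0 v f) (h.memLp_applyA_Ioi 0 v g)
      (h.memLp_applyA_Ioi 1 v f) (h.memLp_applyA_Ioi 1 v g)
      (fun x hx => h.applyA_zero_eq_add f hx) (fun x hx => h.applyA_zero_eq_add g hx)
  have hm := ((h.aestronglyMeasurable_applyA 1 f).mul (h.aestronglyMeasurable_applyA 0 g)).add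
    ((h.aestronglyMeasurable_applyA 0 f).mul (h.aestronglyMeasurable_applyA 1 g))
  have hw := ((h.memLp_applyA_one f).integrable_mul (h.memLp_applyA_zero g)).add
    ((h.memLp_applyA_zero f).integrable_mul (h.memLp_applyA_one g))
  obtain ⟨h1, h2⟩ := integral_integral_Ioi_of_measure_Iio h.mono.measurable h.nonneg
    (measure_stieltjes_Iio_ae h.mono h.tendsto_bot) hm hw
  simp only [Pi.add_apply, Pi.mul_apply, e] at h1 h2
  refine ⟨by simpa using h1.neg, ?_⟩
  rw [← h2, integral_neg]

end Admissible

/-! ### Integration by parts for solutions of G = f + K₂ G -/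

theorem toL2_of_memLp {f : ℝ → ℝ} (hf : MemLp f 2 halfLine) : toL2 f = hf.toLp f := by
  rw [toL2, dif_pos hf]

theorem coeFn_toL2 {f : ℝ → ℝ} (hf : MemLp f 2 halfLine) : toL2 f =ᵐ[halfLine] f := by
  rw [toL2_of_memLp hf]; exact hf.coeFn_toLp

theorem inner_toL2_left {f : ℝ → ℝ} (hf : MemLp f 2 halfLine) (g : L2) :
    inner ℝ (toL2 f) g = ∫ y, f y * g y ∂halfLine := by
  rw [MeasureTheory.L2.inner_def]
  refine integral_congr_ae ?_
  filter_upwards [coeFn_toL2 hf] with y hy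
  simp [hy, mul_comm]

namespace Admissible

variable {A σ : ℝ → ℝ} {s : ℝ} (h : Admissible A σ s)

include h

theorem memLp_kernelK2_column : MemLp (fun x => kernelK2 A σ s x 0) 2 halfLine := by
  have := memLp_integral_kernel h.memLp_kernelA_zero_swap h.memLp_kernelA_boundary
  refine (memLp_congr_ae (Eventually.of_forall fun x => ?_)).1 this
  simp only [h.kernelK2_eq, kernelA_comm 0 x, kernelA_comm 0 0]

theorem integral_kernelK2_column_mul (g : L2) :
    ∫ x, kernelK2 A σ s x 0 * g x ∂halfLine
      = ∫ r, kernelA A s 0 0 r * applyA A s 0 g r ∂(weight σ) := by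
  have := integral_mul_integral_kernel_swap h.memLp_kernelA_zero h.memLp_kernelA_boundary
    (Lp.memLp g)
  refine Eq.trans ?_ this.symm
  simp only [h.kernelK2_eq, fun r => kernelA_comm (A := A) (s := s) 0 r 0]

/-- The continuous representative of `G = f + K₂ G`, where `f` is a square-integrable primitive
of a square-integrable function, is again such a primitive. -/
theorem primitive_of_eq_add_K2 {f f' : ℝ → ℝ}
    (hf' : MemLp f' 2 halfLine) (hff' : ∀ x, 0 ≤ x → f x = f 0 + ∫ z in (0 : ℝ)..x, f' z)
    (G : L2) {x : ℝ} (hx : 0 ≤ x) :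
    f x + ∫ r, kernelA A s 0 x r * applyA A s 0 G r ∂(weight σ)
      = f 0 + ∫ r, kernelA A s 0 0 r * applyA A s 0 G r ∂(weight σ)
        + ∫ z in (0 : ℝ)..x,
            (f' z + ∫ r, kernelA A s 1 z r * applyA A s 0 G r ∂(weight σ)) := by
  have hint : ∀ {w : ℝ → ℝ}, MemLp w 2 halfLine → IntervalIntegrable w volume 0 x := by
    intro w hw
    rw [intervalIntegrable_iff_integrableOn_Ioc_of_le hx]
    have h1 : MemLp w 2 (volume.restrict (Ioc 0 x)) :=
      hw.mono_measure (Measure.restrict_mono Ioc_subset_Ioi_self le_rfl)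
    exact h1.integrable (by norm_num)
  rw [intervalIntegral.integral_add (hint hf')
    (hint (memLp_integral_kernel h.memLp_kernelA_one_swap (h.memLp_applyA_zero G))),
    integral_kernelA_mul_eq_add h.contDiff h.memLp_kernelA_one_swap (h.memLp_applyA_zero G)
      (h.memLp_kernelA_boundary.integrable_mul (h.memLp_applyA_zero G)) hx, hff' x hx]
  ring

/-- Integration by parts for two solutions of `G = f + K₂ G`. -/
theorem integral_deriv_mul_add {f f' e e' : ℝ → ℝ}
    (hf : MemLp f 2 halfLine) (hf' : MemLp f' 2 halfLine)
    (hff' : ∀ x, 0 ≤ x → f x = f 0 + ∫ z in (0 : ℝ)..x, f' z)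
    (he : MemLp e 2 halfLine) (he' : MemLp e' 2 halfLine)
    (hee' : ∀ x, 0 ≤ x → e x = e 0 + ∫ z in (0 : ℝ)..x, e' z)
    {G H : L2} (hG : G = toL2 f + K2 A σ s G) (hH : H = toL2 e + K2 A σ s H) :
    ∫ y, e' y * G y ∂halfLine + ∫ y, f' y * H y ∂halfLine
      = ∫ v, applyA A s 0 H v * applyA A s 0 G v ∂h.mono.stieltjesFunction.measure
        - (e 0 + ∫ x, kernelK2 A σ s x 0 * H x ∂halfLine)
          * (f 0 + ∫ x, kernelK2 A σ s x 0 * G x ∂halfLine) := by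
  set k : ℕ → L2 → ℝ → ℝ := fun p F x =>
    ∫ r, kernelA A s p x r * applyA A s 0 F r ∂(weight σ) with hk
  have hk0 : ∀ F, MemLp (k 0 F) 2 halfLine := fun F =>
    memLp_integral_kernel h.memLp_kernelA_zero_swap (h.memLp_applyA_zero F)
  have hk1 : ∀ F, MemLp (k 1 F) 2 halfLine := fun F =>
    memLp_integral_kernel h.memLp_kernelA_one_swap (h.memLp_applyA_zero F)
  -- G and H are only classes in L², but w + `k 0 F` is a representative with a meaningful value at
  -- 0 and a square-integrable derivative.
  have hrep : ∀ {F : L2} {w : ℝ → ℝ}, MemLp w 2 halfLine → F = toL2 w + K2 A σ s F →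
      ∀ᵐ x ∂halfLine, F x = w x + k 0 F x := by
    intro F w hw hF
    have h1 : F =ᵐ[halfLine] (toL2 w + K2 A σ s F : L2) := by rw [← hF]
    filter_upwards [h1, Lp.coeFn_add (toL2 w) (K2 A σ s F), coeFn_toL2 hw, h.K2_apply F]
      with x hx1 hx2 hx3 hx4
    rw [hx1, hx2, Pi.add_apply, hx3, hx4]
  have hswap : ∀ F F' : L2, ∫ x, k 1 F x * F' x ∂halfLine
      = ∫ r, applyA A s 0 F r * applyA A s 1 F' r ∂(weight σ) := by
    intro F F'
    have := integral_mul_integral_kernel_swap h.memLp_kernelA_one (h.memLp_applyA_zero F)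
      (Lp.memLp F')
    refine Eq.trans ?_ this.symm
    simp only [hk, fun x => kernelA_comm (A := A) (s := s) 1 x]
  have hprod := integral_Ioi_mul_primitive (a := 0) (he.add (hk0 H)) (hf.add (hk0 G))
    (he'.add (hk1 H)) (hf'.add (hk1 G))
    (fun x hx => h.primitive_of_eq_add_K2 he' hee' H hx)
    (fun x hx => h.primitive_of_eq_add_K2 hf' hff' G hx)
  have hG2 := Lp.memLp G
  have hH2 := Lp.memLp H
  have i1 : Integrable (fun x => e' x * G x) halfLine := he'.integrable_mul hG2
  have i2 : Integrable (fun x => k 1 H x * G x) halfLine := (hk1 H).integrable_mul hG2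
  have i3 : Integrable (fun x => f' x * H x) halfLine := hf'.integrable_mul hH2
  have i4 : Integrable (fun x => k 1 G x * H x) halfLine := (hk1 G).integrable_mul hH2
  have hsplit : ∫ z in Ioi (0 : ℝ), ((e' + k 1 H) z * (f + k 0 G) z
      + (e + k 0 H) z * (f' + k 1 G) z)
      = (∫ y, e' y * G y ∂halfLine + ∫ x, k 1 H x * G x ∂halfLine)
        + (∫ y, f' y * H y ∂halfLine + ∫ x, k 1 G x * H x ∂halfLine) := by
    rw [← integral_add i1 i2, ← integral_add i3 i4]
    have i12 : Integrable (fun x => e' x * G x + k 1 H x * G x) halfLine := i1.add i2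
    have i34 : Integrable (fun x => f' x * H x + k 1 G x * H x) halfLine := i3.add i4
    rw [← integral_add i12 i34]
    refine integral_congr_ae ?_
    filter_upwards [hrep hf hG, hrep he hH] with x hx1 hx2
    simp only [Pi.add_apply, ← hx1, ← hx2]
    ring
  obtain ⟨-, hw⟩ := h.integral_weight_deriv_applyA H G
  have i5 : Integrable (fun r => applyA A s 1 H r * applyA A s 0 G r) (weight σ) :=
    (h.memLp_applyA_one H).integrable_mul (h.memLp_applyA_zero G)
  have i6 : Integrable (fun r => applyA A s 0 H r * applyA A s 1 G r) (weight σ) :=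
    (h.memLp_applyA_zero H).integrable_mul (h.memLp_applyA_one G)
  rw [integral_add i5 i6] at hw
  have e1 := hswap G H
  have e2 : ∫ r, applyA A s 0 G r * applyA A s 1 H r ∂(weight σ)
      = ∫ r, applyA A s 1 H r * applyA A s 0 G r ∂(weight σ) := by
    congr 1; ext r; ring
  have hprod' := hsplit.symm.trans hprod
  simp only [Pi.add_apply] at hprod'
  -- The two terms with a differentiated K₂ become the two halves of ∫ σ (A_s H · A_s G)', evaluated
  -- in `hw`.
  rw [hswap H G, e1, e2] at hprod'
  rw [h.integral_kernelK2_column_mul, h.integral_kernelK2_column_mul]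
  simp only [hk] at hprod'
  linarith

/-! ### The two-index recursion and its telescoping sum -/

theorem u_eq_inner (p : ℕ) (t t' : ℝ) :
    u A σ s p t t' = inner ℝ (toL2 (kernelA A s p t)) (resolvent A σ s (toL2 (kernelA A s 0 t'))) :=
  (inner_toL2_left (memLp_kernelA_row h.contDiff h.decay p t) _).symm

variable (hinv : IsUnit (1 - K2 A σ s))

include hinv

/-- Symmetry of the resolvent moves all p derivatives into the L² argument. As a function of v,
u_p(t, v) then involves only the undifferentiated A_s, whatever p is. -/
theorem u_eq_applyA (p : ℕ) (t v : ℝ) :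
    u A σ s p t v = applyA A s 0 (resolvent A σ s (toL2 (kernelA A s p t))) v := by
  rw [h.u_eq_inner, h.inner_resolvent hinv, real_inner_comm,
    inner_toL2_left (memLp_kernelA_row h.contDiff h.decay 0 v)]
  rfl

/-- By the same symmetry, q_p(t) is the value at 0 of the continuous representative of (I - K₂)⁻¹
A^{(p)}(t + · + s): the boundary term of the integration by parts. -/
theorem q_eq (p : ℕ) (t : ℝ) :
    q A σ s p t = kernelA A s p t 0
      + ∫ x, kernelK2 A σ s x 0 * resolvent A σ s (toL2 (kernelA A s p t)) x ∂halfLine := by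
  rw [q, ← inner_toL2_left (memLp_kernelA_row h.contDiff h.decay p t), h.inner_resolvent hinv,
    real_inner_comm, inner_toL2_left h.memLp_kernelK2_column]

theorem integrable_u_mul_u (p k : ℕ) (t t' : ℝ) :
    Integrable (fun v => u A σ s p t v * transpose (u A σ s k) v t')
      h.mono.stieltjesFunction.measure := by
  simp only [transpose, h.u_eq_applyA hinv]
  exact (h.integral_weight_deriv_applyA _ _).1

/-- The two-index function `⟨A^{(j)}(t + · + s), (I - K₂)⁻¹ A^{(k)}(t' + · + s)⟩` satisfies a
first-order recursion. -/
theorem inner_succ_add_inner_succ (j k : ℕ) (t t' : ℝ) :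
    inner ℝ (toL2 (kernelA A s (j + 1) t)) (resolvent A σ s (toL2 (kernelA A s k t')))
      + inner ℝ (toL2 (kernelA A s j t)) (resolvent A σ s (toL2 (kernelA A s (k + 1) t')))
      = mulDeriv h.mono (u A σ s j) (transpose (u A σ s k)) t t'
        - outer (q A σ s j) (q A σ s k) t t' := by
  have hrow := memLp_kernelA_row (s := s) h.contDiff h.decay
  have hprim : ∀ p t x, 0 ≤ x → kernelA A s p t x
      = kernelA A s p t 0 + ∫ z in (0 : ℝ)..x, kernelA A s (p + 1) t z := fun p t x _ => by
    simp only [fun p => kernelA_comm (A := A) (s := s) p t]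
    rw [integral_kernelA_succ h.contDiff]; ring
  have key := h.integral_deriv_mul_add (hrow k t') (hrow (k + 1) t') (hprim k t')
    (hrow j t) (hrow (j + 1) t) (hprim j t) (resolvent_apply hinv _) (resolvent_apply hinv _)
  rw [inner_toL2_left (hrow (j + 1) t), h.inner_resolvent hinv (toL2 (kernelA A s j t)),
    real_inner_comm, inner_toL2_left (hrow (k + 1) t'), key]
  simp only [mulDeriv, transpose, outer, h.u_eq_applyA hinv, h.q_eq hinv]

theorem sum_mulDeriv_sub_outer (m : ℕ) (t t' : ℝ) :
    ∑ k ∈ Finset.range (m + 1), (-1 : ℝ) ^ (k + 1) *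
      (mulDeriv h.mono (u A σ s (m - k)) (transpose (u A σ s k)) t t'
        - outer (q A σ s (m - k)) (q A σ s k) t t')
      = - u A σ s (m + 1) t t' + (-1) ^ (m + 1) * u A σ s (m + 1) t' t := by
  set U : ℕ → ℕ → ℝ := fun j k =>
    inner ℝ (toL2 (kernelA A s j t)) (resolvent A σ s (toL2 (kernelA A s k t'))) with hU
  -- The summand is W(k+1) - W(k): its sign (-1)^{k+1} multiplies U(m-k, k+1) + U(m+1-k, k).
  set W : ℕ → ℝ := fun k => (-1) ^ k * U (m + 1 - k) k
  have hterm : ∀ k ∈ Finset.range (m + 1), (-1 : ℝ) ^ (k + 1) *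
      (mulDeriv h.mono (u A σ s (m - k)) (transpose (u A σ s k)) t t'
        - outer (q A σ s (m - k)) (q A σ s k) t t') = W (k + 1) - W k := by
    intro k hk
    have hk' : k ≤ m := Nat.lt_succ_iff.1 (Finset.mem_range.1 hk)
    rw [← h.inner_succ_add_inner_succ hinv]
    have e1 : m + 1 - (k + 1) = m - k := by omega
    have e2 : m + 1 - k = m - k + 1 := by omega
    simp only [W, hU, e1, e2]
    ring
  rw [Finset.sum_congr rfl hterm, Finset.sum_range_sub]
  simp only [W, hU, h.u_eq_inner, Nat.sub_self, Nat.sub_zero, pow_zero, one_mul]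
  rw [h.inner_resolvent hinv (toL2 (kernelA A s 0 t)), real_inner_comm]
  ring

theorem quantityI_eq_zero (n : ℕ) : quantityI A h.mono s n = 0 := by
  ext t t'
  have hs := h.sum_mulDeriv_sub_outer hinv (2 * n) t t'
  simp only [quantityI, Pi.add_apply, Finset.sum_apply, Pi.smul_apply, Pi.sub_apply, smul_eq_mul,
    Pi.zero_apply]
  rw [hs, Odd.neg_one_pow ⟨n, rfl⟩, transpose]
  ring

theorem quantityJ_eq_zero (n : ℕ) : quantityJ A h.mono s n = 0 := by
  ext t t'
  simp only [quantityJ, Pi.add_apply, Finset.sum_apply, Pi.smul_apply, Pi.sub_apply, smul_eq_mul,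
    Pi.zero_apply]
  rw [show transpose (u A σ s (2 * n)) t t' = u A σ s (2 * n) t' t from rfl]
  -- For n = 0 the sum is empty and the claim is the symmetry of u_0. Otherwise the telescoping
  -- lemma applies with m = 2n - 1, which requires n ≥ 1.
  rcases n with _ | n
  · simp only [Nat.mul_zero, Finset.range_zero, Finset.sum_empty, add_zero, h.u_eq_inner]
    rw [h.inner_resolvent hinv, real_inner_comm, sub_self]
  · have hs := h.sum_mulDeriv_sub_outer hinv (2 * n + 1) t t'
    have e : 2 * (n + 1) = 2 * n + 1 + 1 := by ring
    simp only [e, Nat.add_sub_cancel]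
    rw [hs, Even.neg_one_pow ⟨n + 1, by ring⟩]
    ring

end Admissible

end InhomFredholm

theorem mainTheorem5
    (A : ℝ → ℝ) (hA : ContDiff ℝ ∞ A)
    (hA_decay : ∀ p : ℕ, ∃ c : ℝ, 0 < c ∧
      iteratedDeriv p A =O[atTop] fun x : ℝ => Real.exp (-c * x))
    (σ : ℝ → ℝ) (hσ : Monotone σ) (γ : ℝ) (hγ_pos : 0 < γ) (hγ_le : γ ≤ 1)
    (hσ_bot : Tendsto σ atBot (𝓝 0)) (hσ_top : Tendsto σ atTop (𝓝 γ))
    (s : ℝ)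
    (hHS₀ : InhomFredholm.IsWeightedHilbertSchmidt A σ s 0)
    (hHS₁ : InhomFredholm.IsWeightedHilbertSchmidt A σ s 1)
    (hinv : IsUnit (1 - InhomFredholm.K2 A σ s)) :
    (∀ (p k : ℕ) (t t' : ℝ),
      Integrable (fun v => InhomFredholm.u A σ s p t v *
        InhomFredholm.transpose (InhomFredholm.u A σ s k) v t') hσ.stieltjesFunction.measure) ∧
    ∀ n : ℕ, InhomFredholm.quantityI A hσ s n = 0 ∧ InhomFredholm.quantityJ A hσ s n = 0 := by
  have h : InhomFredholm.Admissible A σ s := ⟨hA, hA_decay, hσ, hσ_bot, hHS₀, hHS₁⟩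
  exact ⟨h.integrable_u_mul_u hinv, fun n =>
    ⟨h.quantityI_eq_zero hinv n, h.quantityJ_eq_zero hinv n⟩⟩
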